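/- Let $\log_q$ denote the deformed logarithm, $\log_q x=\frac{x^{q-1}-1}{q-1}$ for $q\neq 1$ and $\log_1 x=\log x$ ($x>0$), and let $\exp_q$ be its inverse function, the deformed exponential: $\exp_q x=(x(q-1)+1)^{1/(q-1)}$ for $x>-1/(q-1)$ if $q>1$ and for $x<-1/(q-1)$ if $q<1$, and $\exp_1 x=\exp x$ for $x\in\mathbb R$. They are applied to Hermitian matrices by the functional calculus. Let $H$ be a complex $m\times n$ matrix which is a contraction (its operator norm is at most $1$). (i) Let $L$ be a positive definite complex $n\times n$ matrix. For $1\le q\le 3$ and every positive definite $m\times m$ matrix $A$, the spectrum of $L+H^*\log_q(A)H$ lies in the domain of $\exp_q$, and the map $$A\mapsto \operatorname{Tr}\exp_q\bigl(L+H^*\log_q(A)H\bigr),$$ defined on positive definite $m\times m$ matrices, is concave for $1\le q\le 2$ and convex for $2<q\le 3$. (ii) Let $L$ be a positive definite complex $n\times n$ matrix. For $0\le q<1$ and every positive definite $m\times m$ matrix $A$, the spectrum of $-L+H^*\log_q(A)H$ lies in the domain of $\exp_q$, and the map $$A\mapsto \operatorname{Tr}\exp_q\bigl(-L+H^*\log_q(A)H\bigr),$$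 defined on positive definite $m\times m$ matrices, is concave. (iii) For every Hermitian $n\times n$ matrix $L$ (not necessarily definite), the map $$A\mapsto \operatorname{Tr}\exp\bigl(L+H^*\log(A)H\bigr),$$ defined on positive definite $m\times m$ matrices, is concave. -/

import Mathlib

open scoped Matrix ComplexOrder

noncomputable section

/-- The deformed logarithm `log_q` (used for `x > 0`). -/
def logq (q x : ℝ) : ℝ :=
  if q = 1 then Real.log x else (x ^ (q - 1) - 1) / (q - 1)

/-- The domain of the deformed exponential `exp_q`: the half-line `x > -1/(q-1)` for `q > 1`,
the half-line `x < -1/(q-1)` for `q < 1`, and the whole real line for `q = 1`. -/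
def expqDomain (q : ℝ) : Set ℝ :=
  {x | (1 < q → -1 / (q - 1) < x) ∧ (q < 1 → x < -1 / (q - 1))}

/-- The deformed exponential `exp_q` (used for `x ∈ expqDomain q`). -/
def expq (q x : ℝ) : ℝ :=
  if q = 1 then Real.exp x else (x * (q - 1) + 1) ^ (1 / (q - 1))

open scoped Matrix.Norms.L2Operator in
/-- `H` is a contraction: its operator norm with respect to the Euclidean norms is at most `1`. -/
def IsContraction {m n : Type*} [Fintype m] [Fintype n] [DecidableEq n]
    (H : Matrix m n ℂ) : Prop :=
  ‖H‖ ≤ 1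

/-- The Hermitian matrix `L + H* log_q(A) H`, where `log_q(A)` is given by the functional
calculus. -/
def deformedArg {m n : Type*} [Fintype m] [DecidableEq m]
    (q : ℝ) (H : Matrix m n ℂ) (L : Matrix n n ℂ) (A : Matrix m m ℂ) : Matrix n n ℂ :=
  L + Hᴴ * cfc (logq q) A * H

/-- `Tr exp_q(L + H* log_q(A) H)`, where `exp_q` is applied by the functional calculus. The matrix
under the trace is Hermitian, so its trace is real and equal to its real part. -/
def deformedTrace {m n : Type*} [Fintype m] [DecidableEq m] [Fintype n] [DecidableEq n]
    (q : ℝ) (H : Matrix m n ℂ) (L : Matrix n n ℂ) (A : Matrix m m ℂ) : ℝ :=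
  (Matrix.trace (cfc (expq q) (deformedArg q H L A))).re

end

/-! Put p = q - 1. For p ≠ 0 the matrix p (L + H* log_q(A) H) + 1 equals K + H* A^p H with K = p L +
(1 - H* H). Since H is a contraction, K is positive definite as soon as p L is, which dictates the
sign of L. This settles the domain question and leaves Tr (K + H* A^p H)^(1/p).

Bernoulli's inequality says that x^(1/p) is the extremum over z > 0 of (1 - 1/p) z + (1/p) x
z^(1-p), attained at z = x^(1/p): a maximum if p < 0 or 0 < p ≤ 1, a minimum if 1 < p ≤ 2. Klein's
inequality (`trace_klein`) lifts this to traces, with a positive definite matrix Z for z. It then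
suffices that (1/p) Tr H* A^p H Z^(1-p) is jointly concave, respectively convex, in (A, Z), because
partial maximization preserves concavity. This is Lieb's theorem for 0 < p ≤ 1 and Ando's for 1 < p
≤ 2 and -1 ≤ p < 0. The exponential case is analogous, with joint convexity of the relative entropy.

Lieb's and Ando's theorems follow from integral representations of powers, which reduce them to
`isLiebConcave_parallelSum`: the parallel sum of left and right multiplication is a minimum of forms
linear in (A, B). -/

section LiebConcavity

open MeasureTheory Filter Topology

/-! ### Concavity under majorants, partial maximization, limits and integrals -/

section Concavity

variable {E F : Type*} [AddCommGroup E] [Module ℝ E] [AddCommGroup F] [Module ℝ F]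

/-- A function which is at every point of a convex set touched from above by a concave majorant is
concave. -/
lemma concaveOn_of_exists_concave_majorant {S : Set E} (hS : Convex ℝ S) {Φ : E → ℝ}
    (h : ∀ x ∈ S, ∃ ℓ : E → ℝ, ConcaveOn ℝ S ℓ ∧ (∀ y ∈ S, Φ y ≤ ℓ y) ∧ ℓ x = Φ x) :
    ConcaveOn ℝ S Φ := by
  refine ⟨hS, fun x hx y hy a b ha hb hab => ?_⟩
  obtain ⟨ℓ, hℓ, hle, heq⟩ := h _ (hS hx hy ha hb hab)
  rw [← heq]
  refine le_trans ?_ (hℓ.2 hx hy ha hb hab)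
  simp only [smul_eq_mul]
  gcongr
  · exact hle x hx
  · exact hle y hy

/-- Partial maximization of a jointly concave function gives a concave function. -/
lemma concaveOn_of_partial_max {S : Set E} {T : Set F} (hS : Convex ℝ S) {Φ : E → ℝ}
    {G : E × F → ℝ} (hG : ConcaveOn ℝ (S ×ˢ T) G)
    (hle : ∀ x ∈ S, ∀ z ∈ T, G (x, z) ≤ Φ x) (hmax : ∀ x ∈ S, ∃ z ∈ T, G (x, z) = Φ x) :
    ConcaveOn ℝ S Φ := by
  refine ⟨hS, fun x hx y hy a b ha hb hab => ?_⟩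
  obtain ⟨z, hz, hxz⟩ := hmax x hx
  obtain ⟨w, hw, hyw⟩ := hmax y hy
  have hx' : (x, z) ∈ S ×ˢ T := ⟨hx, hz⟩
  have hy' : (y, w) ∈ S ×ˢ T := ⟨hy, hw⟩
  have hm := hG.1 hx' hy' ha hb hab
  rw [← hxz, ← hyw]
  exact (hG.2 hx' hy' ha hb hab).trans (hle _ hm.1 _ hm.2)

lemma concaveOn_of_tendsto {ι : Type*} {l : Filter ι} [l.NeBot] {S : Set E} (hS : Convex ℝ S)
    {f : ι → E → ℝ} {g : E → ℝ} (hf : ∀ᶠ i in l, ConcaveOn ℝ S (f i))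
    (hlim : ∀ x ∈ S, Tendsto (fun i => f i x) l (𝓝 (g x))) : ConcaveOn ℝ S g := by
  refine ⟨hS, fun x hx y hy a b ha hb hab => ?_⟩
  refine le_of_tendsto_of_tendsto (((hlim x hx).const_smul a).add ((hlim y hy).const_smul b))
    (hlim _ (hS hx hy ha hb hab)) ?_
  filter_upwards [hf] with i hi using hi.2 hx hy ha hb hab

lemma concaveOn_integral {S : Set E} (hS : Convex ℝ S) {α : Type*} [MeasurableSpace α]
    {μ : Measure α} {f : α → E → ℝ} (hf : ∀ᵐ t ∂μ, ConcaveOn ℝ S (f t))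
    (hint : ∀ x ∈ S, Integrable (fun t => f t x) μ) : ConcaveOn ℝ S (fun x => ∫ t, f t x ∂μ) := by
  refine ⟨hS, fun x hx y hy a b ha hb hab => ?_⟩
  simp only [smul_eq_mul]
  rw [← integral_const_mul, ← integral_const_mul,
    ← integral_add ((hint x hx).const_mul a) ((hint y hy).const_mul b)]
  refine integral_mono_ae (((hint x hx).const_mul a).add ((hint y hy).const_mul b))
    (hint _ (hS hx hy ha hb hab)) ?_
  filter_upwards [hf] with t ht using ht.2 hx hy ha hb hab

end Concavity

noncomputable section

variable {m n : Type*} [Fintype m] [DecidableEq m] [Fintype n] [DecidableEq n]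

/-! ### Double traces -/

lemma Matrix.convex_setOf_posDef : Convex ℝ {A : Matrix m m ℂ | A.PosDef} := by
  intro A hA B hB a b ha hb hab
  simp only [Set.mem_ofPred_eq] at *
  rcases ha.eq_or_lt with rfl | ha
  · obtain rfl : b = 1 := by linarith
    simpa using hB
  · rcases hb.eq_or_lt with rfl | hb
    · obtain rfl : a = 1 := by linarith
      simpa using hA
    · exact (hA.smul ha).add (hB.smul hb)

variable (m n) in
/-- The pairs of positive definite matrices of sizes `m` and `n`. -/
def posDefPairs : Set (Matrix m m ℂ × Matrix n n ℂ) := {A | A.PosDef} ×ˢ {B | B.PosDef}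

lemma convex_posDefPairs : Convex ℝ (posDefPairs m n) :=
  Matrix.convex_setOf_posDef.prod Matrix.convex_setOf_posDef

/-- The coefficients of `K` with respect to the eigenbases of `A` and `B`. -/
def eigenCoeff (K : Matrix m n ℂ) {A : Matrix m m ℂ} {B : Matrix n n ℂ}
    (hA : A.IsHermitian) (hB : B.IsHermitian) : Matrix m n ℂ :=
  star (hA.eigenvectorUnitary : Matrix m m ℂ) * K * (hB.eigenvectorUnitary : Matrix n n ℂ)

open Classical in
/-- The quadratic form `⟨K, φ(L_A, R_B) K⟩`, where `L_A` is left multiplication by `A` and `R_B`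
right multiplication by `B`. -/
def doubleTrace (φ : ℝ → ℝ → ℝ) (K : Matrix m n ℂ) (A : Matrix m m ℂ) (B : Matrix n n ℂ) : ℝ :=
  if h : A.IsHermitian ∧ B.IsHermitian then
    ∑ i, ∑ j, φ (h.1.eigenvalues i) (h.2.eigenvalues j) * Complex.normSq (eigenCoeff K h.1 h.2 i j)
  else 0

lemma doubleTrace_of_isHermitian (φ : ℝ → ℝ → ℝ) (K : Matrix m n ℂ) {A : Matrix m m ℂ}
    {B : Matrix n n ℂ} (hA : A.IsHermitian) (hB : B.IsHermitian) :
    doubleTrace φ K A B =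
      ∑ i, ∑ j, φ (hA.eigenvalues i) (hB.eigenvalues j) * Complex.normSq (eigenCoeff K hA hB i j) :=
  dif_pos ⟨hA, hB⟩

lemma Matrix.IsHermitian.cfc_eq_mul {A : Matrix m m ℂ} (hA : A.IsHermitian) (f : ℝ → ℝ) :
    cfc f A = (hA.eigenvectorUnitary : Matrix m m ℂ) *
      Matrix.diagonal (fun i => (f (hA.eigenvalues i) : ℂ)) *
      star (hA.eigenvectorUnitary : Matrix m m ℂ) := by
  rw [hA.cfc_eq, Matrix.IsHermitian.cfc, Unitary.conjStarAlgAut_apply]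
  rfl

/-- For separable `φ` the double trace is an actual trace. -/
lemma doubleTrace_mul (f g : ℝ → ℝ) (K : Matrix m n ℂ) {A : Matrix m m ℂ} {B : Matrix n n ℂ}
    (hA : A.IsHermitian) (hB : B.IsHermitian) :
    doubleTrace (fun a b => f a * g b) K A B = (Matrix.trace (Kᴴ * cfc f A * K * cfc g B)).re := by
  rw [doubleTrace_of_isHermitian _ _ hA hB, hA.cfc_eq_mul, hB.cfc_eq_mul]
  set U := (hA.eigenvectorUnitary : Matrix m m ℂ)
  set V := (hB.eigenvectorUnitary : Matrix n n ℂ)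
  have hW : (eigenCoeff K hA hB)ᴴ = star V * Kᴴ * U := by
    simp [eigenCoeff, Matrix.conjTranspose_mul, ← Matrix.star_eq_conjTranspose, U, V,
      Matrix.mul_assoc]
  have key : Matrix.trace (Kᴴ * (U * Matrix.diagonal (fun i => (f (hA.eigenvalues i) : ℂ)) * star U)
      * K * (V * Matrix.diagonal (fun i => (g (hB.eigenvalues i) : ℂ)) * star V)) =
      Matrix.trace ((eigenCoeff K hA hB)ᴴ * Matrix.diagonal (fun i => (f (hA.eigenvalues i) : ℂ)) *
        eigenCoeff K hA hB * Matrix.diagonal (fun i => (g (hB.eigenvalues i) : ℂ))) := by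
    rw [hW, ← Matrix.mul_assoc _ _ (star V), Matrix.trace_mul_comm _ (star V)]
    simp only [eigenCoeff, Matrix.mul_assoc]
    rfl
  rw [key, Matrix.trace, Finset.sum_comm, Complex.re_sum]
  refine Finset.sum_congr rfl fun j _ => ?_
  simp only [Matrix.diag_apply]
  rw [Matrix.mul_diagonal, Matrix.mul_apply, Finset.sum_mul, Complex.re_sum]
  refine Finset.sum_congr rfl fun i _ => ?_
  rw [Matrix.mul_diagonal, Matrix.conjTranspose_apply]
  generalize eigenCoeff K hA hB i j = w
  simp [Complex.normSq_apply]
  ring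

lemma doubleTrace_add (φ ψ : ℝ → ℝ → ℝ) (K : Matrix m n ℂ) (A : Matrix m m ℂ) (B : Matrix n n ℂ) :
    doubleTrace (fun a b => φ a b + ψ a b) K A B = doubleTrace φ K A B + doubleTrace ψ K A B := by
  unfold doubleTrace
  split_ifs
  · simp only [add_mul, Finset.sum_add_distrib]
  · simp

lemma doubleTrace_const_mul (c : ℝ) (φ : ℝ → ℝ → ℝ) (K : Matrix m n ℂ) (A : Matrix m m ℂ)
    (B : Matrix n n ℂ) :
    doubleTrace (fun a b => c * φ a b) K A B = c * doubleTrace φ K A B := by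
  unfold doubleTrace
  split_ifs
  · simp only [mul_assoc, Finset.mul_sum]
  · simp

lemma doubleTrace_congr {φ ψ : ℝ → ℝ → ℝ} (h : ∀ a b, 0 < a → 0 < b → φ a b = ψ a b)
    (K : Matrix m n ℂ) {A : Matrix m m ℂ} {B : Matrix n n ℂ} (hA : A.PosDef) (hB : B.PosDef) :
    doubleTrace φ K A B = doubleTrace ψ K A B := by
  rw [doubleTrace_of_isHermitian _ _ hA.1 hB.1, doubleTrace_of_isHermitian _ _ hA.1 hB.1]
  simp only [h _ _ (hA.eigenvalues_pos _) (hB.eigenvalues_pos _)]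

lemma eigenCoeff_conjTranspose (K : Matrix m n ℂ) {A : Matrix m m ℂ} {B : Matrix n n ℂ}
    (hA : A.IsHermitian) (hB : B.IsHermitian) :
    eigenCoeff Kᴴ hB hA = (eigenCoeff K hA hB)ᴴ := by
  simp [eigenCoeff, Matrix.conjTranspose_mul, ← Matrix.star_eq_conjTranspose, Matrix.mul_assoc]

lemma doubleTrace_swap (φ : ℝ → ℝ → ℝ) (K : Matrix m n ℂ) {A : Matrix m m ℂ} {B : Matrix n n ℂ}
    (hA : A.IsHermitian) (hB : B.IsHermitian) :
    doubleTrace (fun a b => φ b a) K A B = doubleTrace φ Kᴴ B A := by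
  rw [doubleTrace_of_isHermitian _ _ hA hB, doubleTrace_of_isHermitian _ _ hB hA, Finset.sum_comm,
    eigenCoeff_conjTranspose]
  simp [Matrix.conjTranspose_apply]

/-! ### Lieb concave functions and their closure properties -/

variable (m n) in
/-- `φ` is Lieb concave (in sizes `m`, `n`) if all the quadratic forms `⟨K, φ(L_A, R_B) K⟩` are
jointly concave in the positive definite matrices `A` and `B`. -/
def IsLiebConcave (φ : ℝ → ℝ → ℝ) : Prop :=
  ∀ K : Matrix m n ℂ, ConcaveOn ℝ (posDefPairs m n) (fun P => doubleTrace φ K P.1 P.2)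

namespace IsLiebConcave

lemma congr {φ ψ : ℝ → ℝ → ℝ} (hφ : IsLiebConcave m n φ)
    (h : ∀ a b, 0 < a → 0 < b → φ a b = ψ a b) : IsLiebConcave m n ψ := fun K =>
  (hφ K).congr fun P hP => doubleTrace_congr h K hP.1 hP.2

lemma add {φ ψ : ℝ → ℝ → ℝ} (hφ : IsLiebConcave m n φ) (hψ : IsLiebConcave m n ψ) :
    IsLiebConcave m n (fun a b => φ a b + ψ a b) := fun K => by
  simp only [doubleTrace_add]
  exact (hφ K).add (hψ K)

lemma const_mul {φ : ℝ → ℝ → ℝ} (hφ : IsLiebConcave m n φ) {c : ℝ} (hc : 0 ≤ c) :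
    IsLiebConcave m n (fun a b => c * φ a b) := fun K => by
  simp only [doubleTrace_const_mul]
  exact (hφ K).smul hc

lemma swap {φ : ℝ → ℝ → ℝ} (hφ : IsLiebConcave n m φ) :
    IsLiebConcave m n (fun a b => φ b a) := fun K => by
  refine ConcaveOn.congr ?_ fun P hP => (doubleTrace_swap φ K hP.1.1 hP.2.1).symm
  refine ⟨convex_posDefPairs, fun P hP Q hQ a b ha hb hab => ?_⟩
  exact (hφ Kᴴ).2 (x := P.swap) ⟨hP.2, hP.1⟩ (y := Q.swap) ⟨hQ.2, hQ.1⟩ ha hb hab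

/-- For fixed matrices the double trace is a finite combination of values of φ at pairs of
eigenvalues, so pointwise convergence on positive reals is enough. -/
lemma of_tendsto {ι : Type*} {l : Filter ι} [l.NeBot] {φ : ι → ℝ → ℝ → ℝ} {ψ : ℝ → ℝ → ℝ}
    (hφ : ∀ᶠ i in l, IsLiebConcave m n (φ i))
    (hlim : ∀ a b, 0 < a → 0 < b → Tendsto (fun i => φ i a b) l (𝓝 (ψ a b))) :
    IsLiebConcave m n ψ := fun K => by
  refine concaveOn_of_tendsto convex_posDefPairs (hφ.mono fun i hi => hi K) fun P hP => ?_
  simp only [doubleTrace_of_isHermitian _ _ hP.1.1 hP.2.1]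
  exact tendsto_finsetSum _ fun i _ => tendsto_finsetSum _ fun j _ =>
    (hlim _ _ (Matrix.PosDef.eigenvalues_pos hP.1 i)
      (Matrix.PosDef.eigenvalues_pos hP.2 j)).mul_const _

lemma integral {α : Type*} [MeasurableSpace α] {μ : Measure α} {φ : α → ℝ → ℝ → ℝ}
    (hφ : ∀ᵐ t ∂μ, IsLiebConcave m n (φ t))
    (hint : ∀ a b, 0 < a → 0 < b → Integrable (fun t => φ t a b) μ) :
    IsLiebConcave m n (fun a b => ∫ t, φ t a b ∂μ) := fun K => by
  have hint' : ∀ P ∈ posDefPairs m n, ∀ (hA : P.1.IsHermitian) (hB : P.2.IsHermitian) i j,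
      Integrable (fun t => φ t (hA.eigenvalues i) (hB.eigenvalues j) *
        Complex.normSq (eigenCoeff K hA hB i j)) μ := fun P hP hA hB i j =>
    (hint _ _ (Matrix.PosDef.eigenvalues_pos hP.1 i)
      (Matrix.PosDef.eigenvalues_pos hP.2 j)).mul_const _
  refine (concaveOn_integral convex_posDefPairs (hφ.mono fun t ht => ht K)
    fun P hP => ?_).congr fun P hP => ?_
  · simp only [doubleTrace_of_isHermitian _ _ hP.1.1 hP.2.1]
    exact integrable_finsetSum _ fun i _ => integrable_finsetSum _ fun j _ =>
      hint' P hP _ _ i j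
  · simp only [doubleTrace_of_isHermitian _ _ hP.1.1 hP.2.1]
    rw [integral_finsetSum _ fun i _ => integrable_finsetSum _ fun j _ => hint' P hP _ _ i j]
    refine Finset.sum_congr rfl fun i _ => ?_
    rw [integral_finsetSum _ fun j _ => hint' P hP _ _ i j]
    exact Finset.sum_congr rfl fun j _ => integral_mul_const _ _

end IsLiebConcave

/-! ### Linear terms and the parallel sum -/

lemma doubleTrace_fst (K : Matrix m n ℂ) {A : Matrix m m ℂ} {B : Matrix n n ℂ}
    (hA : A.IsHermitian) (hB : B.IsHermitian) :
    doubleTrace (fun a _ => a) K A B = (Matrix.trace (Kᴴ * A * K)).re := by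
  have h := doubleTrace_mul (fun a => a) (fun _ => 1) K hA hB
  rw [cfc_id' ℝ A hA.isSelfAdjoint, cfc_const_one ℝ B hB.isSelfAdjoint] at h
  simpa using h

lemma doubleTrace_snd (K : Matrix m n ℂ) {A : Matrix m m ℂ} {B : Matrix n n ℂ}
    (hA : A.IsHermitian) (hB : B.IsHermitian) :
    doubleTrace (fun _ b => b) K A B = (Matrix.trace (Kᴴ * K * B)).re := by
  have h := doubleTrace_mul (fun _ => 1) (fun b => b) K hA hB
  rw [cfc_id' ℝ B hB.isSelfAdjoint, cfc_const_one ℝ A hA.isSelfAdjoint] at h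
  simpa using h

/-- The map `X ↦ Re Tr (M X)` as a real-linear map. -/
def reTraceMul (M : Matrix n n ℂ) : Matrix n n ℂ →ₗ[ℝ] ℝ :=
  Complex.reLm ∘ₗ (Matrix.traceLinearMap n ℝ ℂ) ∘ₗ LinearMap.mulLeft ℝ M

lemma concaveOn_doubleTrace_fst (c : ℝ) (K : Matrix m n ℂ) :
    ConcaveOn ℝ (posDefPairs m n) (fun P => doubleTrace (fun a _ => c * a) K P.1 P.2) := by
  refine ConcaveOn.congr (((c • reTraceMul (K * Kᴴ)) ∘ₗ
    LinearMap.fst ℝ (Matrix m m ℂ) (Matrix n n ℂ)).concaveOn convex_posDefPairs) fun P hP => ?_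
  change c * (Matrix.trace (K * Kᴴ * P.1)).re = _
  rw [doubleTrace_const_mul c (fun a _ => a), doubleTrace_fst K hP.1.1 hP.2.1, Matrix.mul_assoc,
    Matrix.trace_mul_comm]

lemma concaveOn_doubleTrace_snd (c : ℝ) (K : Matrix m n ℂ) :
    ConcaveOn ℝ (posDefPairs m n) (fun P => doubleTrace (fun _ b => c * b) K P.1 P.2) := by
  refine ConcaveOn.congr (((c • reTraceMul (Kᴴ * K)) ∘ₗ
    LinearMap.snd ℝ (Matrix m m ℂ) (Matrix n n ℂ)).concaveOn convex_posDefPairs) fun P hP => ?_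
  change c * (Matrix.trace (Kᴴ * K * P.2)).re = _
  rw [doubleTrace_const_mul c (fun _ b => b), doubleTrace_snd K hP.1.1 hP.2.1]

lemma isLiebConcave_fst (c : ℝ) : IsLiebConcave m n (fun a _ => c * a) :=
  concaveOn_doubleTrace_fst c

lemma isLiebConcave_snd (c : ℝ) : IsLiebConcave m n (fun _ b => c * b) :=
  concaveOn_doubleTrace_snd c

/-- Completing the square: the difference of the two sides is |(a + b) x - b k|² / (a + b), which
vanishes at x = b k / (a + b). -/
lemma parallelSum_normSq_le {a b : ℝ} (ha : 0 < a) (hb : 0 < b) (k x : ℂ) :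
    a * b / (a + b) * Complex.normSq k ≤ a * Complex.normSq x + b * Complex.normSq (k - x) := by
  have hab : 0 < a + b := by positivity
  have key : a * Complex.normSq x + b * Complex.normSq (k - x) - a * b / (a + b) * Complex.normSq k
      = Complex.normSq ((a + b : ℝ) * x - (b : ℝ) * k) / (a + b) := by
    simp only [Complex.normSq_apply, Complex.sub_re, Complex.sub_im, Complex.re_ofReal_mul,
      Complex.im_ofReal_mul]
    field_simp
    ring
  have := div_nonneg (Complex.normSq_nonneg ((a + b : ℝ) * x - (b : ℝ) * k)) hab.le
  linarith

lemma parallelSum_normSq_eq {a b : ℝ} (ha : 0 < a) (hb : 0 < b) (k : ℂ) :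
    a * Complex.normSq ((b / (a + b) : ℝ) * k) + b * Complex.normSq (k - (b / (a + b) : ℝ) * k) =
      a * b / (a + b) * Complex.normSq k := by
  have hab : 0 < a + b := by positivity
  simp only [Complex.normSq_apply, Complex.sub_re, Complex.sub_im, Complex.re_ofReal_mul,
      Complex.im_ofReal_mul]
  field_simp
  ring

lemma eigenCoeff_sub (K X : Matrix m n ℂ) {A : Matrix m m ℂ} {B : Matrix n n ℂ}
    (hA : A.IsHermitian) (hB : B.IsHermitian) :
    eigenCoeff (K - X) hA hB = eigenCoeff K hA hB - eigenCoeff X hA hB := by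
  simp [eigenCoeff, Matrix.mul_sub, Matrix.sub_mul]

/-- Lets a minimizer chosen entry by entry in the eigenbases come from an actual matrix. -/
lemma exists_eigenCoeff_eq (Y : Matrix m n ℂ) {A : Matrix m m ℂ} {B : Matrix n n ℂ}
    (hA : A.IsHermitian) (hB : B.IsHermitian) : ∃ X : Matrix m n ℂ, eigenCoeff X hA hB = Y := by
  refine ⟨(hA.eigenvectorUnitary : Matrix m m ℂ) * Y *
    star (hB.eigenvectorUnitary : Matrix n n ℂ), ?_⟩
  have h1 := Unitary.coe_star_mul_self hA.eigenvectorUnitary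
  have h2 := Unitary.coe_star_mul_self hB.eigenvectorUnitary
  simp only [eigenCoeff]
  rw [Matrix.mul_assoc, Matrix.mul_assoc _ (star _), h2, Matrix.mul_one, ← Matrix.mul_assoc, h1,
    Matrix.one_mul]

/-- Joint concavity of the parallel sum of `L_A` and `t R_B`. -/
lemma isLiebConcave_parallelSum {t : ℝ} (ht : 0 < t) :
    IsLiebConcave m n (fun a b => a * (t * b) / (a + t * b)) := fun K => by
  refine concaveOn_of_exists_concave_majorant convex_posDefPairs fun P hP => ?_
  have hA := hP.1.1
  have hB := hP.2.1
  -- X has as coefficients the scalar minimizers for the eigenvalues of P. Held fixed while Q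
  -- varies, it gives a majorant linear in Q that touches at P.
  obtain ⟨X, hX⟩ := exists_eigenCoeff_eq (Matrix.of fun i j =>
    ((t * hB.eigenvalues j / (hA.eigenvalues i + t * hB.eigenvalues j) : ℝ) : ℂ) *
      eigenCoeff K hA hB i j) hA hB
  refine ⟨fun Q => doubleTrace (fun a _ => 1 * a) X Q.1 Q.2 +
    doubleTrace (fun _ b => t * b) (K - X) Q.1 Q.2,
    (concaveOn_doubleTrace_fst 1 X).add (concaveOn_doubleTrace_snd t (K - X)), fun Q hQ => ?_, ?_⟩
  · simp only [doubleTrace_of_isHermitian _ _ hQ.1.1 hQ.2.1, ← Finset.sum_add_distrib, one_mul,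
      eigenCoeff_sub, Matrix.sub_apply]
    exact Finset.sum_le_sum fun i _ => Finset.sum_le_sum fun j _ => parallelSum_normSq_le
      (Matrix.PosDef.eigenvalues_pos hQ.1 i)
      (mul_pos ht (Matrix.PosDef.eigenvalues_pos hQ.2 j)) _ _
  · simp only [doubleTrace_of_isHermitian _ _ hA hB, ← Finset.sum_add_distrib, one_mul,
      eigenCoeff_sub, Matrix.sub_apply, hX, Matrix.of_apply]
    exact Finset.sum_congr rfl fun i _ => Finset.sum_congr rfl fun j _ => parallelSum_normSq_eq
      (Matrix.PosDef.eigenvalues_pos hP.1 i)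
      (mul_pos ht (Matrix.PosDef.eigenvalues_pos hP.2 j)) _

/-! ### Lieb's and Ando's theorems and the relative entropy -/

open Real in
/-- **Lieb's concavity theorem**, interior exponents. -/
lemma isLiebConcave_rpow_of_mem_Ioo {p : ℝ} (hp : p ∈ Set.Ioo 0 1) :
    IsLiebConcave m n (fun a b => a ^ p * b ^ (1 - p)) := by
  have hC : 0 ≤ (∫ t in Set.Ioi 0, rpowIntegrand₀₁ p t 1)⁻¹ :=
    inv_nonneg.2 (integral_rpowIntegrand₀₁_one_pos hp).le
  -- Write a^p b^(1-p) = b (a/b)^p and use the integral representation of x^p; the integrand becomes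
  -- t^(p-1) / t times the parallel sum of a and t b.
  refine IsLiebConcave.congr (IsLiebConcave.const_mul (IsLiebConcave.integral
    (μ := volume.restrict (Set.Ioi 0)) (φ := fun t a b => b * rpowIntegrand₀₁ p t (a / b))
    ?_ ?_) hC) ?_
  · filter_upwards [ae_restrict_mem measurableSet_Ioi] with t ht
    have ht : 0 < t := ht
    refine ((isLiebConcave_parallelSum ht).const_mul
      (c := t ^ (p - 1) / t) (by positivity)).congr fun a b ha hb => ?_
    rw [rpowIntegrand₀₁_eq_pow_div hp ht.le (by positivity)]
    field_simp
    ring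
  · intro a b ha hb
    exact (integrableOn_rpowIntegrand₀₁_Ioi hp (by positivity)).const_mul b
  · intro a b ha hb
    rw [integral_const_mul, mul_left_comm, ← rpow_eq_const_mul_integral hp (by positivity),
      div_rpow ha.le hb.le, rpow_sub hb, rpow_one]
    field_simp

open Real in
/-- **Ando's convexity theorem**, interior exponents. -/
lemma isLiebConcave_neg_rpow_of_mem_Ioo {p : ℝ} (hp : p ∈ Set.Ioo 1 2) :
    IsLiebConcave m n (fun a b => -(a ^ p * b ^ (1 - p))) := by
  obtain ⟨r, rfl⟩ : ∃ r, p = r + 1 := ⟨p - 1, by ring⟩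
  have hr : r ∈ Set.Ioo (0 : ℝ) 1 := ⟨by linarith [hp.1], by linarith [hp.2]⟩
  have hC : 0 ≤ (∫ t in Set.Ioi 0, rpowIntegrand₀₁ r t 1)⁻¹ :=
    inv_nonneg.2 (integral_rpowIntegrand₀₁_one_pos hr).le
  -- Now a^(r+1) b^(-r) = a (a/b)^r, and -a (a/b) / (t + a/b) = -a + a (t b) / (a + t b) is linear
  -- plus a parallel sum.
  refine IsLiebConcave.congr (IsLiebConcave.const_mul (IsLiebConcave.integral
    (μ := volume.restrict (Set.Ioi 0)) (φ := fun t a b => (-a) * rpowIntegrand₀₁ r t (a / b))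
    ?_ ?_) hC) ?_
  · filter_upwards [ae_restrict_mem measurableSet_Ioi] with t ht
    have ht : 0 < t := ht
    refine (((isLiebConcave_fst (-1)).add (isLiebConcave_parallelSum ht)).const_mul
      (c := t ^ (r - 1)) (by positivity)).congr fun a b ha hb => ?_
    rw [rpowIntegrand₀₁_eq_pow_div hr ht.le (by positivity)]
    field_simp
    ring
  · intro a b ha hb
    exact (integrableOn_rpowIntegrand₀₁_Ioi hr (by positivity)).const_mul (-a)
  · intro a b ha hb
    rw [integral_const_mul, mul_left_comm, ← rpow_eq_const_mul_integral hr (by positivity),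
      div_rpow ha.le hb.le, show 1 - (r + 1) = -r by ring, rpow_neg hb.le, rpow_add_one ha.ne']
    field_simp

lemma tendsto_rpow_mul_rpow {a b : ℝ} (ha : 0 < a) (hb : 0 < b) (p : ℝ) (S : Set ℝ) :
    Tendsto (fun r : ℝ => a ^ r * b ^ (1 - r)) (𝓝[S] p) (𝓝 (a ^ p * b ^ (1 - p))) := by
  have h : Continuous fun r : ℝ => a ^ r * b ^ (1 - r) :=
    (Real.continuous_const_rpow ha.ne').mul
      ((Real.continuous_const_rpow hb.ne').comp (continuous_const.sub continuous_id))
  exact (h.tendsto p).mono_left nhdsWithin_le_nhds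

/-- **Lieb's concavity theorem**. -/
lemma isLiebConcave_rpow {p : ℝ} (h0 : 0 < p) (h1 : p ≤ 1) :
    IsLiebConcave m n (fun a b => a ^ p * b ^ (1 - p)) := by
  rcases h1.eq_or_lt with rfl | h1
  · simpa using isLiebConcave_fst (m := m) (n := n) 1
  · exact isLiebConcave_rpow_of_mem_Ioo ⟨h0, h1⟩

/-- **Ando's convexity theorem**. -/
lemma isLiebConcave_neg_rpow {p : ℝ} (h1 : 1 < p) (h2 : p ≤ 2) :
    IsLiebConcave m n (fun a b => -(a ^ p * b ^ (1 - p))) := by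
  rcases h2.eq_or_lt with rfl | h2
  -- The integral representation only covers p < 2; the endpoint is a limit from the left.
  · refine IsLiebConcave.of_tendsto (l := 𝓝[<] (2 : ℝ)) (φ := fun r a b => -(a ^ r * b ^ (1 - r)))
      ?_ fun a b ha hb => (tendsto_rpow_mul_rpow ha hb 2 _).neg
    filter_upwards [Ioo_mem_nhdsLT (show (1 : ℝ) < 2 by norm_num)] with r hr
      using isLiebConcave_neg_rpow_of_mem_Ioo hr
  · exact isLiebConcave_neg_rpow_of_mem_Ioo ⟨h1, h2⟩

/-- Ando's convexity theorem with a negative exponent on the first matrix. -/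
lemma isLiebConcave_neg_rpow_of_neg {p : ℝ} (h1 : -1 ≤ p) (h0 : p < 0) :
    IsLiebConcave m n (fun a b => -(a ^ p * b ^ (1 - p))) := by
  refine IsLiebConcave.congr (isLiebConcave_neg_rpow (m := n) (n := m) (p := 1 - p)
    (by linarith) (by linarith)).swap fun a b ha hb => ?_
  rw [sub_sub_cancel, mul_comm]

/-- Joint convexity of the relative entropy. -/
lemma isLiebConcave_mul_log :
    IsLiebConcave m n (fun a b => Real.log a * b + -(b * Real.log b)) := by
  -- The relative entropy is the derivative at exponent 0: b ((a/b)^r - 1) / r tends to b log (a/b).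
  refine IsLiebConcave.of_tendsto (l := 𝓝[>] (0 : ℝ))
    (φ := fun r a b => r⁻¹ * (a ^ r * b ^ (1 - r) + (-1) * b)) ?_ fun a b ha hb => ?_
  · filter_upwards [Ioo_mem_nhdsGT (show (0 : ℝ) < 1 by norm_num)] with r hr
    exact ((isLiebConcave_rpow_of_mem_Ioo hr).add (isLiebConcave_snd (-1))).const_mul
      (inv_nonneg.2 hr.1.le)
  · have hd := ((Real.hasStrictDerivAt_const_rpow (div_pos ha hb) 0).hasDerivAt.const_mul
      b).tendsto_slope_zero_right
    convert hd using 2 with r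
    · rw [zero_add, Real.rpow_zero, Real.div_rpow ha.le hb.le, Real.rpow_sub hb, Real.rpow_one,
        smul_eq_mul]
      field_simp
      ring
    · rw [Real.rpow_zero, Real.log_div ha.ne' hb.ne']
      ring

/-- Freezing the first matrix at 1 handles the terms that depend on the auxiliary variable Z alone.
-/
lemma IsLiebConcave.concaveOn_one_left {φ : ℝ → ℝ → ℝ} (hφ : IsLiebConcave n n φ)
    (S : Matrix n n ℂ) :
    ConcaveOn ℝ (posDefPairs m n) (fun P => doubleTrace φ S 1 P.2) := by
  refine ⟨convex_posDefPairs, fun P hP Q hQ a b ha hb hab => ?_⟩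
  have h := (hφ S).2 (x := (1, P.2)) ⟨Matrix.PosDef.one, hP.2⟩ (y := (1, Q.2))
    ⟨Matrix.PosDef.one, hQ.2⟩ ha hb hab
  have h1 : a • (1 : Matrix n n ℂ) + b • (1 : Matrix n n ℂ) = 1 := by rw [← add_smul, hab, one_smul]
  simpa [h1] using h

/-! ### Spectral facts, Klein's and Bernoulli's inequalities -/

lemma Matrix.IsHermitian.continuousOn_spectrum {A : Matrix m m ℂ} (hA : A.IsHermitian)
    (f : ℝ → ℝ) : ContinuousOn f (spectrum ℝ A) :=
  (Matrix.finite_real_spectrum (A := A)).continuousOn f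

lemma Matrix.PosDef.pos_of_mem_spectrum {A : Matrix m m ℂ} (hA : A.PosDef) {x : ℝ}
    (hx : x ∈ spectrum ℝ A) : 0 < x := by
  rw [hA.1.spectrum_real_eq_range_eigenvalues] at hx
  obtain ⟨i, rfl⟩ := hx
  exact hA.eigenvalues_pos i

lemma Matrix.IsHermitian.posDef_cfc {A : Matrix m m ℂ} (hA : A.IsHermitian) {f : ℝ → ℝ}
    (hf : ∀ x ∈ spectrum ℝ A, 0 < f x) : (cfc f A).PosDef := by
  rw [hA.cfc_eq_mul]
  refine (Matrix.IsUnit.posDef_star_right_conjugate_iff Unitary.isUnit_coe).2 ?_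
  refine Matrix.PosDef.diagonal fun i => ?_
  exact_mod_cast hf _ (hA.eigenvalues_mem_spectrum_real i)

/-- **Klein's inequality** -/
lemma trace_klein {X Z : Matrix n n ℂ} (hX : X.IsHermitian) (hZ : Z.IsHermitian)
    (f g h k : ℝ → ℝ)
    (hle : ∀ x ∈ spectrum ℝ X, ∀ z ∈ spectrum ℝ Z, g z + h x * k z ≤ f x) :
    (Matrix.trace (cfc g Z)).re + (Matrix.trace (cfc h X * cfc k Z)).re ≤
      (Matrix.trace (cfc f X)).re := by
  -- With K = 1 all three traces are sums over pairs of eigenvalues with the same nonnegative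
  -- weights, the squared overlaps of the eigenvectors, so the scalar inequality can be summed.
  have h1 := doubleTrace_mul (fun _ => 1) g 1 hX hZ
  have h2 := doubleTrace_mul h k 1 hX hZ
  have h3 := doubleTrace_mul f (fun _ => 1) 1 hX hZ
  simp only [cfc_const_one ℝ X hX.isSelfAdjoint, cfc_const_one ℝ Z hZ.isSelfAdjoint,
    Matrix.conjTranspose_one, one_mul, mul_one] at h1 h2 h3
  rw [← h1, ← h2, ← h3, ← doubleTrace_add, doubleTrace_of_isHermitian _ _ hX hZ,
    doubleTrace_of_isHermitian _ _ hX hZ]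
  exact Finset.sum_le_sum fun i _ => Finset.sum_le_sum fun j _ => mul_le_mul_of_nonneg_right
    (hle _ (hX.eigenvalues_mem_spectrum_real i) _ (hZ.eigenvalues_mem_spectrum_real j))
    (Complex.normSq_nonneg _)

/-- Bernoulli's inequality for exponents outside `(0, 1)`. -/
lemma bernoulli_rpow {s u : ℝ} (hs : s ≤ 0 ∨ 1 ≤ s) (hu : 0 < u) : 1 - s + s * u ≤ u ^ s := by
  rcases hs with hs | hs
  · have hd : 0 < 1 - s := by linarith
    -- The weights make the powers of u cancel in the geometric mean of u^s and u, which is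
    -- therefore 1.
    have h := Real.geom_mean_le_arith_mean2_weighted (w₁ := 1 / (1 - s)) (w₂ := -s / (1 - s))
      (p₁ := u ^ s) (p₂ := u) (by positivity) (div_nonneg (by linarith) hd.le) (by positivity) hu.le
      (by rw [← add_div, ← sub_eq_add_neg, div_self hd.ne'])
    rw [← Real.rpow_mul hu.le, ← Real.rpow_add hu,
      show s * (1 / (1 - s)) + -s / (1 - s) = 0 by ring, Real.rpow_zero] at h
    have h' := mul_le_mul_of_nonneg_left h hd.le
    have e : (1 - s) * (1 / (1 - s) * u ^ s + -s / (1 - s) * u) = u ^ s - s * u := by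
      field_simp
      ring
    linarith
  · have h := one_add_mul_self_le_rpow_one_add (s := u - 1) (by linarith) hs
    rw [add_sub_cancel] at h
    linarith

/-- Bernoulli's inequality for exponents in `[0, 1]`. -/
lemma rpow_bernoulli {s u : ℝ} (h0 : 0 ≤ s) (h1 : s ≤ 1) (hu : 0 < u) :
    u ^ s ≤ 1 - s + s * u := by
  have h := rpow_one_add_le_one_add_mul_self (s := u - 1) (by linarith) h0 h1
  rw [add_sub_cancel] at h
  linarith

/-- Both sides of Bernoulli's inequality with exponent 1/p at u = x / z^p, multiplied by z: this is
the variational formula for x^(1/p). -/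
lemma rpow_mul_rescale {p x z : ℝ} (hp : p ≠ 0) (hx : 0 < x) (hz : 0 < z) :
    z * (x / z ^ p) ^ p⁻¹ = x ^ p⁻¹ ∧
      z * (1 - p⁻¹ + p⁻¹ * (x / z ^ p)) = (1 - p⁻¹) * z + p⁻¹ * (x * z ^ (1 - p)) := by
  constructor
  · rw [Real.div_rpow hx.le (by positivity), Real.rpow_rpow_inv hz.le hp]
    field_simp
  · rw [Real.rpow_sub hz, Real.rpow_one]
    have := Real.rpow_pos_of_pos hz p
    field_simp

/-! ### The variational principle and the trace functions -/

/-- Variational principle: if `F x = max_z (g z + x * k z)`, attained at `z = h x`, then concavity of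
`Tr F(X A)` follows from joint concavity of `Tr g(Z) + Tr (X A) k(Z)`. -/
lemma concaveOn_trace_cfc_of_variational {X : Matrix m m ℂ → Matrix n n ℂ} {D : Set ℝ}
    {F g h k : ℝ → ℝ} (hX : ∀ A : Matrix m m ℂ, A.PosDef → (X A).IsHermitian)
    (hD : ∀ A : Matrix m m ℂ, A.PosDef → spectrum ℝ (X A) ⊆ D)
    (hle : ∀ x ∈ D, ∀ z, 0 < z → g z + x * k z ≤ F x)
    (hpos : ∀ x ∈ D, 0 < h x) (heq : ∀ x ∈ D, g (h x) + x * k (h x) = F x)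
    (hconc : ConcaveOn ℝ (posDefPairs m n) (fun P =>
      (Matrix.trace (cfc g P.2)).re + (Matrix.trace (X P.1 * cfc k P.2)).re)) :
    ConcaveOn ℝ {A : Matrix m m ℂ | A.PosDef} (fun A => (Matrix.trace (cfc F (X A))).re) := by
  refine concaveOn_of_partial_max Matrix.convex_setOf_posDef hconc (fun A hA Z hZ => ?_)
    fun A hA => ?_
  · have hk := trace_klein (hX A hA) hZ.1 F g (fun x => x) k fun x hx z hz =>
      hle x (hD A hA hx) z (Matrix.PosDef.pos_of_mem_spectrum hZ hz)
    rwa [cfc_id' ℝ (X A) (hX A hA).isSelfAdjoint] at hk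
  · have hXA := hX A hA
    have hc := hXA.continuousOn_spectrum
    have hc' : ∀ f : ℝ → ℝ, ContinuousOn f (h '' spectrum ℝ (X A)) := fun f =>
      (Matrix.finite_real_spectrum.image h).continuousOn f
    -- The maximizer Z = h(X A) commutes with X A, so the trace identity reduces to the scalar
    -- identity on the spectrum.
    refine ⟨cfc h (X A), hXA.posDef_cfc fun x hx => hpos x (hD A hA hx), ?_⟩
    dsimp only
    rw [← cfc_comp' g h (X A) (hc' g) (hc h) hXA.isSelfAdjoint,
      ← cfc_comp' k h (X A) (hc' k) (hc h) hXA.isSelfAdjoint]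
    conv_lhs =>
      enter [2, 1, 1, 1]
      rw [← cfc_id' ℝ (X A) hXA.isSelfAdjoint]
    rw [← cfc_mul _ _ _ (hc _) (hc _), ← Complex.add_re, ← Matrix.trace_add,
      ← cfc_add _ _ _ (hc _) (hc _)]
    congr 2
    exact cfc_congr fun x hx => heq x (hD A hA hx)

lemma Matrix.PosSemidef.exists_conjTranspose_mul_self {M : Matrix n n ℂ} (hM : M.PosSemidef) :
    ∃ S : Matrix n n ℂ, M = Sᴴ * S := by
  open scoped MatrixOrder in
  exact CStarAlgebra.nonneg_iff_eq_star_mul_self.mp hM.nonneg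

lemma concaveOn_reTraceMul_snd (M : Matrix n n ℂ) :
    ConcaveOn ℝ (posDefPairs m n) (fun P => (Matrix.trace (M * P.2)).re) :=
  (reTraceMul M ∘ₗ LinearMap.snd ℝ (Matrix m m ℂ) (Matrix n n ℂ)).concaveOn convex_posDefPairs

lemma isHermitian_add_conj_cfc {L : Matrix n n ℂ} (hL : L.IsHermitian) (H : Matrix m n ℂ)
    (f : ℝ → ℝ) (A : Matrix m m ℂ) : (L + Hᴴ * cfc f A * H).IsHermitian :=
  hL.add (Matrix.isHermitian_conjTranspose_mul_mul H
    (IsSelfAdjoint.cfc : IsSelfAdjoint (cfc f A)))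

lemma posDef_add_conj_rpow {K : Matrix n n ℂ} (hK : K.PosDef) (H : Matrix m n ℂ) (p : ℝ)
    {A : Matrix m m ℂ} (hA : A.PosDef) : (K + Hᴴ * cfc (fun x : ℝ => x ^ p) A * H).PosDef :=
  hK.add_posSemidef ((hA.1.posDef_cfc fun x hx =>
    Real.rpow_pos_of_pos (hA.pos_of_mem_spectrum hx) p).posSemidef.conjTranspose_mul_mul_same H)

/-- Concavity of `σ Tr (K + H* A^p H)^(1/p)`; the sign `σ` decides between concavity and
convexity. -/
lemma concaveOn_trace_rpow_inv {p σ : ℝ} (hp : p ≠ 0)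
    (hmn : IsLiebConcave m n (fun a b => a ^ p * (σ * p⁻¹ * b ^ (1 - p))))
    (hnn : IsLiebConcave n n (fun a b => a ^ p * (σ * p⁻¹ * b ^ (1 - p))))
    (hle : ∀ u : ℝ, 0 < u → σ * (1 - p⁻¹ + p⁻¹ * u) ≤ σ * u ^ p⁻¹)
    {K : Matrix n n ℂ} (hK : K.PosDef) (H : Matrix m n ℂ) :
    ConcaveOn ℝ {A : Matrix m m ℂ | A.PosDef} (fun A => σ *
      (Matrix.trace (cfc (fun x : ℝ => x ^ p⁻¹) (K + Hᴴ * cfc (fun x : ℝ => x ^ p) A * H))).re) := by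
  have hX := fun A : Matrix m m ℂ => posDef_add_conj_rpow hK H p (A := A)
  obtain ⟨S, hS⟩ := hK.posSemidef.exists_conjTranspose_mul_self
  have key : ConcaveOn ℝ {A : Matrix m m ℂ | A.PosDef} (fun A => (Matrix.trace
      (cfc (fun x : ℝ => σ * x ^ p⁻¹) (K + Hᴴ * cfc (fun x : ℝ => x ^ p) A * H))).re) := by
    refine concaveOn_trace_cfc_of_variational (D := Set.Ioi 0)
      (g := fun z => σ * (1 - p⁻¹) * z) (h := fun x => x ^ p⁻¹)
      (k := fun z => σ * p⁻¹ * z ^ (1 - p)) (fun A hA => (hX A hA).1)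
      (fun A hA x hx => (hX A hA).pos_of_mem_spectrum hx) (fun x hx z hz => ?_)
      (fun x hx => Real.rpow_pos_of_pos hx _) (fun x hx => ?_) ?_
    · have hx : 0 < x := hx
      obtain ⟨h1, h2⟩ := rpow_mul_rescale hp hx hz
      have h := mul_le_mul_of_nonneg_left (hle (x / z ^ p) (by positivity)) hz.le
      rw [mul_left_comm, mul_left_comm z, h1, h2] at h
      linarith
    · have hx : 0 < x := hx
      rw [Real.rpow_sub (by positivity), Real.rpow_one, Real.rpow_inv_rpow hx.le hp]
      field_simp
      ring
    -- Tr K Z^(1-p) with K = S* S is the double trace of S with first matrix 1, so it falls under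
    -- the same theorem as the term with H and A.
    · refine (((concaveOn_reTraceMul_snd ((σ * (1 - p⁻¹)) • (1 : Matrix n n ℂ))).add
        (hnn.concaveOn_one_left S)).add (hmn H)).congr fun P hP => ?_
      have h1 : cfc (fun z : ℝ => σ * (1 - p⁻¹) * z) P.2 = (σ * (1 - p⁻¹)) • P.2 :=
        cfc_const_mul_id _ _ hP.2.1.isSelfAdjoint
      have h2 : cfc (fun x : ℝ => x ^ p) (1 : Matrix n n ℂ) = 1 := by
        rw [cfc_apply_one, Real.one_rpow, map_one]
      simp only [Pi.add_apply]
      rw [doubleTrace_mul (fun a => a ^ p) (fun b => σ * p⁻¹ * b ^ (1 - p)) S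
          Matrix.isHermitian_one hP.2.1,
        doubleTrace_mul (fun a => a ^ p) (fun b => σ * p⁻¹ * b ^ (1 - p)) H hP.1.1 hP.2.1,
        h1, h2, Matrix.mul_one, ← hS, Matrix.add_mul, Matrix.trace_add, Complex.add_re,
        Matrix.smul_mul, Matrix.one_mul, add_assoc]
  refine key.congr fun A hA => ?_
  dsimp only
  rw [cfc_const_mul σ _ _ ((hX A hA).1.continuousOn_spectrum _), Matrix.trace_smul]
  simp

lemma concaveOn_trace_rpow_inv_of_pos {p : ℝ} (h0 : 0 < p) (h1 : p ≤ 1)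
    {K : Matrix n n ℂ} (hK : K.PosDef) (H : Matrix m n ℂ) :
    ConcaveOn ℝ {A : Matrix m m ℂ | A.PosDef} (fun A =>
      (Matrix.trace (cfc (fun x : ℝ => x ^ p⁻¹) (K + Hᴴ * cfc (fun x : ℝ => x ^ p) A * H))).re) := by
  have hp := inv_nonneg.2 h0.le
  have h := concaveOn_trace_rpow_inv (σ := 1) h0.ne'
    (((isLiebConcave_rpow (m := m) (n := n) h0 h1).const_mul hp).congr fun a b _ _ => by ring)
    (((isLiebConcave_rpow (m := n) (n := n) h0 h1).const_mul hp).congr fun a b _ _ => by ring)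
    (fun u hu => by simpa using bernoulli_rpow (Or.inr ((one_le_inv₀ h0).2 h1)) hu) hK H
  simpa using h

/-- Joint convexity from Ando's theorem is turned into concavity by the negative factor 1/p, while
Bernoulli's inequality for the exponent 1/p < 0 still gives a maximum. -/
lemma concaveOn_trace_rpow_inv_of_neg {p : ℝ} (h1 : -1 ≤ p) (h0 : p < 0)
    {K : Matrix n n ℂ} (hK : K.PosDef) (H : Matrix m n ℂ) :
    ConcaveOn ℝ {A : Matrix m m ℂ | A.PosDef} (fun A =>
      (Matrix.trace (cfc (fun x : ℝ => x ^ p⁻¹) (K + Hᴴ * cfc (fun x : ℝ => x ^ p) A * H))).re) := by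
  have hp : 0 ≤ -p⁻¹ := neg_nonneg.2 (inv_nonpos.2 h0.le)
  have h := concaveOn_trace_rpow_inv (σ := 1) h0.ne
    (((isLiebConcave_neg_rpow_of_neg (m := m) (n := n) h1 h0).const_mul hp).congr
      fun a b _ _ => by ring)
    (((isLiebConcave_neg_rpow_of_neg (m := n) (n := n) h1 h0).const_mul hp).congr
      fun a b _ _ => by ring)
    (fun u hu => by simpa using bernoulli_rpow (Or.inl (inv_nonpos.2 h0.le)) hu) hK H
  simpa using h

/-- Here 0 < 1/p < 1 reverses Bernoulli's inequality, so the trace is a minimum of jointly convex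
functions; σ = -1 turns it into a maximum. -/
lemma convexOn_trace_rpow_inv {p : ℝ} (h1 : 1 < p) (h2 : p ≤ 2)
    {K : Matrix n n ℂ} (hK : K.PosDef) (H : Matrix m n ℂ) :
    ConvexOn ℝ {A : Matrix m m ℂ | A.PosDef} (fun A =>
      (Matrix.trace (cfc (fun x : ℝ => x ^ p⁻¹) (K + Hᴴ * cfc (fun x : ℝ => x ^ p) A * H))).re) := by
  have h0 : 0 < p := by linarith
  have hp := inv_nonneg.2 h0.le
  have h := concaveOn_trace_rpow_inv (σ := -1) h0.ne'
    (((isLiebConcave_neg_rpow (m := m) (n := n) h1 h2).const_mul hp).congr fun a b _ _ => by ring)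
    (((isLiebConcave_neg_rpow (m := n) (n := n) h1 h2).const_mul hp).congr fun a b _ _ => by ring)
    (fun u hu => by linarith [rpow_bernoulli hp (inv_le_one_of_one_le₀ h1.le) hu]) hK H
  refine neg_concaveOn_iff.1 (h.congr fun A _ => ?_)
  simp

/-- Concavity of `Tr exp (L + H* log(A) H)` for a contraction `H`. -/
lemma concaveOn_trace_exp_log {H : Matrix m n ℂ} (hH : (1 - Hᴴ * H).PosSemidef)
    {L : Matrix n n ℂ} (hL : L.IsHermitian) :
    ConcaveOn ℝ {A : Matrix m m ℂ | A.PosDef}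
      (fun A => (Matrix.trace (cfc Real.exp (L + Hᴴ * cfc Real.log A * H))).re) := by
  obtain ⟨S, hS⟩ := hH.exists_conjTranspose_mul_self
  refine concaveOn_trace_cfc_of_variational (D := Set.univ) (g := fun z => z + -(z * Real.log z))
    (h := Real.exp) (k := fun z => z) (fun A _ => isHermitian_add_conj_cfc hL H _ A)
    (fun A _ => Set.subset_univ _) (fun x _ z hz => ?_) (fun x _ => Real.exp_pos x)
    (fun x _ => by simp only [Real.log_exp]; ring) ?_
  -- The tangent line of exp at log z: z (1 + x - log z) ≤ exp x.
  · have h := mul_le_mul_of_nonneg_left (Real.add_one_le_exp (x - Real.log z)) hz.le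
    rw [Real.exp_sub, Real.exp_log hz, mul_div_cancel₀ _ hz.ne'] at h
    linarith
  -- The entropy -Tr Z log Z is split along 1 = S* S + H* H. The H part joins Tr H* log(A) H Z to
  -- form a relative entropy; the S part is a relative entropy with first matrix 1, where log 1 = 0.
  -- Since L enters linearly, its sign is irrelevant.
  · refine (((concaveOn_reTraceMul_snd (1 + L)).add
      (isLiebConcave_mul_log.concaveOn_one_left S)).add (isLiebConcave_mul_log H)).congr
      fun P hP => ?_
    have hB := hP.2.1
    have hc := Matrix.IsHermitian.continuousOn_spectrum hB
    have hlog : cfc Real.log (1 : Matrix n n ℂ) = 0 := by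
      rw [cfc_apply_one, Real.log_one, map_zero]
    have e1 := doubleTrace_mul Real.log (fun z => z) S Matrix.isHermitian_one hB
    have e2 := doubleTrace_mul (fun _ => 1) (fun z => -(z * Real.log z)) S Matrix.isHermitian_one hB
    have e3 := doubleTrace_mul Real.log (fun z => z) H hP.1.1 hB
    have e4 := doubleTrace_mul (fun _ => 1) (fun z => -(z * Real.log z)) H hP.1.1 hB
    simp only [one_mul] at e2 e4
    have hid := cfc_id' ℝ P.2 hB.isSelfAdjoint
    rw [cfc_const_one ℝ _ Matrix.isHermitian_one.isSelfAdjoint, Matrix.mul_one, ← hS] at e2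
    rw [cfc_const_one ℝ _ hP.1.1.isSelfAdjoint, Matrix.mul_one] at e4
    rw [hlog, Matrix.mul_zero, Matrix.zero_mul, Matrix.zero_mul, Matrix.trace_zero,
      Complex.zero_re] at e1
    simp only [Pi.add_apply, doubleTrace_add]
    rw [e1, e2, e3, e4, cfc_add _ _ _ (hc _) (hc _), hid]
    simp only [Matrix.add_mul, Matrix.sub_mul, Matrix.one_mul, Matrix.trace_add, Matrix.trace_sub,
      Complex.add_re, Complex.sub_re]
    ring

/-! ### Reduction of deformed exponentials to powers -/

lemma IsContraction.posSemidef_one_sub {H : Matrix m n ℂ} (hH : IsContraction H) :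
    (1 - Hᴴ * H).PosSemidef := by
  have hM : (Hᴴ * H).PosSemidef := Matrix.posSemidef_conjTranspose_mul_self H
  open scoped MatrixOrder Matrix.Norms.L2Operator in
  have h1 : ‖Hᴴ * H‖ ≤ 1 := by
    rw [Matrix.l2_opNorm_conjTranspose_mul_self]
    exact mul_le_one₀ hH (norm_nonneg _) hH
  open scoped MatrixOrder Matrix.Norms.L2Operator in
  exact Matrix.le_iff.1 ((CStarAlgebra.norm_le_one_iff_of_nonneg _ hM.nonneg).1 h1)

/-- The constant -1 in (q - 1) log_q x = x^(q-1) - 1 contributes -H* H, which the added identity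
completes to the defect 1 - H* H. -/
lemma smul_deformedArg_add_one {q : ℝ} (hq : q ≠ 1) (H : Matrix m n ℂ) (L : Matrix n n ℂ)
    {A : Matrix m m ℂ} (hA : A.IsHermitian) :
    (q - 1) • deformedArg q H L A + 1 =
      ((q - 1) • L + (1 - Hᴴ * H)) + Hᴴ * cfc (fun x : ℝ => x ^ (q - 1)) A * H := by
  have hq' : q - 1 ≠ 0 := sub_ne_zero.2 hq
  have hc := hA.continuousOn_spectrum
  have h : (q - 1) • cfc (logq q) A = cfc (fun x : ℝ => x ^ (q - 1)) A - 1 := by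
    rw [← cfc_const_mul _ _ _ (hc _), ← cfc_const_one ℝ A hA.isSelfAdjoint,
      ← cfc_sub _ _ _ (hc _) (hc _)]
    refine cfc_congr fun x _ => ?_
    simp only [logq, if_neg hq]
    field_simp
  rw [deformedArg, smul_add, ← Matrix.smul_mul, ← Matrix.mul_smul, h, Matrix.mul_sub,
    Matrix.sub_mul, Matrix.mul_one]
  abel

lemma cfc_mul_add_one {M : Matrix n n ℂ} (hM : M.IsHermitian) (c : ℝ) :
    cfc (fun x : ℝ => x * c + 1) M = c • M + 1 := by
  have hc := hM.continuousOn_spectrum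
  rw [cfc_add _ _ _ (hc _) (hc _), cfc_const_one ℝ M hM.isSelfAdjoint]
  simp only [mul_comm _ c]
  rw [cfc_const_mul_id c M hM.isSelfAdjoint]

lemma isHermitian_deformedArg (q : ℝ) (H : Matrix m n ℂ) {L : Matrix n n ℂ} (hL : L.IsHermitian)
    (A : Matrix m m ℂ) : (deformedArg q H L A).IsHermitian :=
  isHermitian_add_conj_cfc hL H _ A

/-- The positive definite constant part of `(q - 1) (L + H* log_q(A) H) + 1`. -/
lemma posDef_smul_add_one_sub {H : Matrix m n ℂ} (hH : IsContraction H) {c : ℝ}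
    {L : Matrix n n ℂ} (hL : (c • L).PosDef) : (c • L + (1 - Hᴴ * H)).PosDef :=
  hL.add_posSemidef hH.posSemidef_one_sub

/-- By spectral mapping, positive definiteness of the shifted matrix means x (q - 1) + 1 > 0 on the
spectrum, which is the domain condition for either sign of q - 1. -/
lemma spectrum_deformedArg_subset {q : ℝ} (hq : q ≠ 1) {H : Matrix m n ℂ} (hH : IsContraction H)
    {L : Matrix n n ℂ} (hLh : L.IsHermitian) (hL : ((q - 1) • L).PosDef) {A : Matrix m m ℂ}
    (hA : A.PosDef) : spectrum ℝ (deformedArg q H L A) ⊆ expqDomain q := by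
  intro x hx
  have hM := isHermitian_deformedArg q H hLh A
  have hpd := posDef_add_conj_rpow (posDef_smul_add_one_sub hH hL) H (q - 1) hA
  rw [← smul_deformedArg_add_one hq H L hA.1, ← cfc_mul_add_one hM] at hpd
  have hpos : 0 < x * (q - 1) + 1 := by
    refine hpd.pos_of_mem_spectrum ?_
    rw [cfc_map_spectrum _ _ hM.isSelfAdjoint (hM.continuousOn_spectrum _)]
    exact ⟨x, hx, rfl⟩
  refine ⟨fun h => ?_, fun h => ?_⟩
  · rw [div_lt_iff₀ (by linarith)]
    linarith
  · rw [lt_div_iff_of_neg (by linarith)]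
    linarith

lemma deformedTrace_eq {q : ℝ} (hq : q ≠ 1) (H : Matrix m n ℂ) {L : Matrix n n ℂ}
    (hL : L.IsHermitian) {A : Matrix m m ℂ} (hA : A.PosDef) :
    deformedTrace q H L A = (Matrix.trace (cfc (fun x : ℝ => x ^ (q - 1)⁻¹)
      (((q - 1) • L + (1 - Hᴴ * H)) + Hᴴ * cfc (fun x : ℝ => x ^ (q - 1)) A * H))).re := by
  have hM := isHermitian_deformedArg q H hL A
  rw [← smul_deformedArg_add_one hq H L hA.1, ← cfc_mul_add_one hM,
    ← cfc_comp' _ _ _ ((Matrix.finite_real_spectrum.image _).continuousOn _)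
      (hM.continuousOn_spectrum _) hM.isSelfAdjoint, deformedTrace]
  congr 3
  funext x
  simp only [expq, if_neg hq, one_div]

lemma logq_one : logq 1 = Real.log := funext fun x => if_pos rfl

lemma expq_one : expq 1 = Real.exp := funext fun x => if_pos rfl

end

end LiebConcavity

theorem corollary2p6 {m n : Type*} [Fintype m] [DecidableEq m] [Fintype n] [DecidableEq n]
    (H : Matrix m n ℂ) (hH : IsContraction H) :
    (∀ L : Matrix n n ℂ, L.PosDef → ∀ q : ℝ,
      (1 ≤ q → q ≤ 2 →
        (∀ A : Matrix m m ℂ, A.PosDef → spectrum ℝ (deformedArg q H L A) ⊆ expqDomain q) ∧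
        ConcaveOn ℝ {A : Matrix m m ℂ | A.PosDef} (fun A => deformedTrace q H L A)) ∧
      (2 < q → q ≤ 3 →
        (∀ A : Matrix m m ℂ, A.PosDef → spectrum ℝ (deformedArg q H L A) ⊆ expqDomain q) ∧
        ConvexOn ℝ {A : Matrix m m ℂ | A.PosDef} (fun A => deformedTrace q H L A)) ∧
      (0 ≤ q → q < 1 →
        (∀ A : Matrix m m ℂ, A.PosDef → spectrum ℝ (deformedArg q H (-L) A) ⊆ expqDomain q) ∧
        ConcaveOn ℝ {A : Matrix m m ℂ | A.PosDef} (fun A => deformedTrace q H (-L) A))) ∧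
    (∀ L : Matrix n n ℂ, L.IsHermitian →
      ConcaveOn ℝ {A : Matrix m m ℂ | A.PosDef}
        (fun A => (Matrix.trace (cfc Real.exp (L + Hᴴ * cfc Real.log A * H))).re)) := by
  refine ⟨fun L hL q => ⟨fun h1 h2 => ?_, fun h2 h3 => ?_, fun h0 h1 => ?_⟩,
    fun L hL => concaveOn_trace_exp_log hH.posSemidef_one_sub hL⟩
  · rcases h1.eq_or_lt with rfl | h1
    · refine ⟨fun A _ x _ => ⟨fun h => absurd h (lt_irrefl _), fun h => absurd h (lt_irrefl _)⟩, ?_⟩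
      simpa only [deformedTrace, deformedArg, logq_one, expq_one] using
        concaveOn_trace_exp_log hH.posSemidef_one_sub hL.1
    · have hqL : ((q - 1) • L).PosDef := hL.smul (sub_pos.2 h1)
      exact ⟨fun A hA => spectrum_deformedArg_subset h1.ne' hH hL.1 hqL hA,
        (concaveOn_trace_rpow_inv_of_pos (sub_pos.2 h1) (by linarith)
          (posDef_smul_add_one_sub hH hqL) H).congr
          fun A hA => (deformedTrace_eq h1.ne' H hL.1 hA).symm⟩
  · have h1 : 1 < q := by linarith
    have hqL : ((q - 1) • L).PosDef := hL.smul (sub_pos.2 h1)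
    exact ⟨fun A hA => spectrum_deformedArg_subset h1.ne' hH hL.1 hqL hA,
      (convexOn_trace_rpow_inv (by linarith) (by linarith)
        (posDef_smul_add_one_sub hH hqL) H).congr
        fun A hA => (deformedTrace_eq h1.ne' H hL.1 hA).symm⟩
  -- For q < 1 the factor q - 1 is negative, so -L makes the constant term positive definite.
  · have hqL : ((q - 1) • (-L)).PosDef := by
      rw [smul_neg, ← neg_smul]
      exact hL.smul (by linarith)
    exact ⟨fun A hA => spectrum_deformedArg_subset h1.ne hH hL.1.neg hqL hA,
      (concaveOn_trace_rpow_inv_of_neg (by linarith) (by linarith)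
        (posDef_smul_add_one_sub hH hqL) H).congr
        fun A hA => (deformedTrace_eq h1.ne H hL.1.neg hA).symm⟩
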